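/- Let $\theta$ be an irrational real number and let $A_\theta$ be the irrational rotation $C^*$-algebra, generated by two unitaries $U,V$ with $VU=e^{2\pi i\theta}UV$. Let $\tau$ be its canonical trace ($\tau(1)=1$, $\tau(U^nV^m)=0$ for $(n,m)\neq(0,0)$), and let $A_\theta^\infty$ be the subalgebra of those $x\in A_\theta$ for which $s\mapsto\alpha_s(x)$ is a smooth map $\mathbb R^2\to A_\theta$, where $\alpha_s(U^nV^m)=e^{is\cdot(n,m)}U^nV^m$. Let $h=h^*\in A_\theta^\infty$, $k=e^{h/2}$, and $\varphi(a)=\tau(ae^{-h})$. Let $\mathcal H_\varphi$ be the completion of $A_\theta$ for the inner product $\langle a,b\rangle_\varphi=\varphi(b^*a)$, and let $\Delta$ be the modular operator, i.e. the bounded operator on $\mathcal H_\varphi$ that extends $x\mapsto e^{-h}xe^{h}$ $(x\in A_\theta)$. For an integer $m\ge 0$ and $u>0$ put $$\mathcal L_m(u)=\int_0^\infty \frac{x^m}{(x+1)^{m+1}}\,\frac{1}{xu+1}\,dx .$$ (1) For every $u>0$ the integral $\mathcal L_m(u)$ converges absolutely, $\mathcal L_m$ is continuous on $(0,\infty)$,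 and for $u>0$, $u\ne 1$ it is the modified logarithm $$\mathcal L_m(u)=(-1)^m(u-1)^{-(m+1)}\Bigl(\log u-\sum_{j=1}^m(-1)^{j+1}\frac{(u-1)^j}{j}\Bigr).$$ (2) $\Delta$ is self-adjoint with spectrum contained in $(0,\infty)$, so that $\mathcal L_m(\Delta)$ is defined by the continuous functional calculus, and the canonical map $A_\theta\to\mathcal H_\varphi$ is injective. (3) For every $u>0$ the element $k^2u+1$ is invertible, and for every $\rho\in A_\theta^\infty$ the integral below converges absolutely in the norm of $A_\theta$ and, as vectors of $\mathcal H_\varphi$ (in which $A_\theta$ is embedded by the canonical map), $$\int_0^\infty \frac{k^{2m+2}u^m}{(k^2u+1)^{m+1}}\,\rho\,\frac{1}{k^2u+1}\,du=\mathcal L_m(\Delta)(\rho).$$ -/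

import Mathlib

noncomputable section

namespace NCTorus

open scoped ContDiff InnerProductSpace ComplexOrder

/-! ## The irrational rotation algebra, in its regular representation -/

/-- The Hilbert space `ℓ²(ℤ²)`; the basis vector at `(n, m)` stands for `Uⁿ Vᵐ`. -/
abbrev H0 : Type := lp (fun _ : ℤ × ℤ => ℂ) 2

lemma memℓp_shift (g : ℤ × ℤ) (c : ℤ × ℤ → Circle) (ξ : H0) :
    Memℓp (fun p => (c p : ℂ) * ξ (p - g) : ℤ × ℤ → ℂ) 2 := by
  have h := (lp.memℓp ξ).summable (by norm_num)
  refine memℓp_gen ?_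
  have h2 := (Equiv.subRight g).summable_iff.mpr h
  refine h2.congr fun p => ?_
  simp [Circle.norm_coe]

/-- The weighted shift `(W ξ)(p) = c(p) ξ(p - g)` on `ℓ²(ℤ²)`, for a phase function `c`. -/
def weightedShift (g : ℤ × ℤ) (c : ℤ × ℤ → Circle) : H0 →L[ℂ] H0 :=
  LinearMap.mkContinuous
    { toFun := fun ξ => ⟨fun p => (c p : ℂ) * ξ (p - g), memℓp_shift g c ξ⟩
      map_add' := fun ξ η => by
        ext p
        exact mul_add _ _ _
      map_smul' := fun z ξ => by
        ext p
        exact mul_left_comm _ _ _ } 1 (fun ξ => by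
    rw [one_mul, lp.norm_eq_tsum_rpow (by norm_num), lp.norm_eq_tsum_rpow (by norm_num)]
    refine le_of_eq ?_
    congr 1
    rw [← (Equiv.subRight g).tsum_eq (fun p => ‖ξ p‖ ^ (2 : ENNReal).toReal)]
    refine tsum_congr fun p => ?_
    simp [Circle.norm_coe])

@[simp] lemma weightedShift_apply (g : ℤ × ℤ) (c : ℤ × ℤ → Circle) (ξ : H0) (p : ℤ × ℤ) :
    weightedShift g c ξ p = (c p : ℂ) * ξ (p - g) := rfl

lemma weightedShift_mul (g g' : ℤ × ℤ) (c c' : ℤ × ℤ → Circle) :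
    weightedShift g c * weightedShift g' c' =
      weightedShift (g + g') (fun p => c p * c' (p - g)) := by
  ext ξ p
  change (c p : ℂ) * ((c' (p - g) : ℂ) * ξ (p - g - g')) = _
  simp [mul_assoc, sub_sub]

lemma weightedShift_zero_one : weightedShift 0 (fun _ => 1) = 1 := by
  ext ξ p
  simp

lemma star_weightedShift (g : ℤ × ℤ) (c : ℤ × ℤ → Circle) :
    star (weightedShift g c) = weightedShift (-g) (fun p => (c (p + g))⁻¹) := by
  symm
  rw [ContinuousLinearMap.star_eq_adjoint, ContinuousLinearMap.eq_adjoint_iff]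
  intro ξ η
  rw [lp.inner_eq_tsum, lp.inner_eq_tsum, ← (Equiv.subRight g).tsum_eq]
  refine tsum_congr fun p => ?_
  simp only [weightedShift_apply, Circle.coe_inv_eq_conj, Equiv.subRight_apply, sub_add_cancel,
    sub_neg_eq_add, RCLike.inner_apply, map_mul, Complex.conj_conj]
  ring

lemma smul_weightedShift (z : Circle) (g : ℤ × ℤ) (c : ℤ × ℤ → Circle) :
    (z : ℂ) • weightedShift g c = weightedShift g (fun p => z * c p) := by
  ext ξ p
  change (z : ℂ) * ((c p : ℂ) * ξ (p - g)) = _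
  simp [mul_assoc]

/-- The phase `e^{2 π i θ}`. -/
def lam (θ : ℝ) : Circle := Circle.exp (2 * Real.pi * θ)

/-- The generator `U`: left multiplication by `U` on the basis `Uⁿ Vᵐ`. -/
def opU : H0 →L[ℂ] H0 := weightedShift (1, 0) (fun _ => 1)

/-- The generator `V`: left multiplication by `V`, so `V Uⁿ Vᵐ = e^{2 π i θ n} Uⁿ Vᵐ⁺¹`. -/
def opV (θ : ℝ) : H0 →L[ℂ] H0 := weightedShift (0, 1) (fun p => lam θ ^ p.1)

lemma opU_unitary : star opU * opU = 1 ∧ opU * star opU = 1 := by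
  simp only [opU, star_weightedShift, weightedShift_mul, ← weightedShift_zero_one]
  constructor <;> congr 1 <;> simp

lemma opV_unitary (θ : ℝ) : star (opV θ) * opV θ = 1 ∧ opV θ * star (opV θ) = 1 := by
  simp only [opV, star_weightedShift, weightedShift_mul, ← weightedShift_zero_one]
  constructor <;> congr 1 <;> simp

lemma opV_mul_opU (θ : ℝ) :
    opV θ * opU = Complex.exp (2 * Real.pi * Complex.I * θ) • (opU * opV θ) := by
  have h : Complex.exp (2 * Real.pi * Complex.I * θ) = (lam θ : ℂ) := by
    rw [lam, Circle.coe_exp]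
    congr 1
    push_cast
    ring
  rw [h]
  simp only [opU, opV, weightedShift_mul, smul_weightedShift]
  congr 1
  funext p
  simp [zpow_sub_one]

/-- The C*-algebra generated by `U` and `V` inside the bounded operators on `ℓ²(ℤ²)`. -/
def rotationSubalgebra (θ : ℝ) : StarSubalgebra ℂ (H0 →L[ℂ] H0) :=
  (StarAlgebra.adjoin ℂ {opU, opV θ}).topologicalClosure

instance rotationSubalgebra_isClosed (θ : ℝ) :
    IsClosed (rotationSubalgebra θ : Set (H0 →L[ℂ] H0)) :=
  StarSubalgebra.isClosed_topologicalClosure _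

lemma opU_mem (θ : ℝ) : opU ∈ rotationSubalgebra θ :=
  StarSubalgebra.le_topologicalClosure _ (StarAlgebra.subset_adjoin ℂ _ (by simp))

lemma opV_mem (θ : ℝ) : opV θ ∈ rotationSubalgebra θ :=
  StarSubalgebra.le_topologicalClosure _ (StarAlgebra.subset_adjoin ℂ _ (by simp))

lemma rotationSubalgebra_le {θ : ℝ} {S : StarSubalgebra ℂ (H0 →L[ℂ] H0)}
    (hS : IsClosed (S : Set (H0 →L[ℂ] H0))) (hU : opU ∈ S) (hV : opV θ ∈ S) :
    rotationSubalgebra θ ≤ S := by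
  refine StarSubalgebra.topologicalClosure_minimal ?_ hS
  refine StarAlgebra.adjoin_le ?_
  rintro x (rfl | rfl)
  · exact hU
  · exact hV

/-- The rotation C*-algebra `A_θ`. -/
def RotationAlgebra (θ : ℝ) : Type := rotationSubalgebra θ

instance (θ : ℝ) : CStarAlgebra (RotationAlgebra θ) :=
  inferInstanceAs (CStarAlgebra (rotationSubalgebra θ))

/-- The usual order of a C*-algebra: the positive elements are the `star b * b`. -/
instance (θ : ℝ) : PartialOrder (RotationAlgebra θ) := CStarAlgebra.spectralOrder _

instance (θ : ℝ) : StarOrderedRing (RotationAlgebra θ) := CStarAlgebra.spectralOrderedRing _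

/-- The inclusion of `A_θ` in the bounded operators on `ℓ²(ℤ²)`. -/
def toOp (θ : ℝ) : RotationAlgebra θ →⋆ₐ[ℂ] (H0 →L[ℂ] H0) := (rotationSubalgebra θ).subtype

lemma toOp_mem {θ : ℝ} (a : RotationAlgebra θ) : toOp θ a ∈ rotationSubalgebra θ := a.2

/-! ## The torus action and smooth elements -/

/-- The diagonal unitary implementing the torus action: `Uⁿ Vᵐ ↦ e^{i s·(n, m)} Uⁿ Vᵐ`. -/
def torusUnitary (s : ℝ × ℝ) : H0 →L[ℂ] H0 :=
  weightedShift 0 (fun p => Circle.exp (s.1 * p.1 + s.2 * p.2))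

lemma torusUnitary_star (s : ℝ × ℝ) :
    star (torusUnitary s) * torusUnitary s = 1 ∧ torusUnitary s * star (torusUnitary s) = 1 := by
  simp only [torusUnitary, star_weightedShift, weightedShift_mul, ← weightedShift_zero_one]
  constructor <;> congr 1 <;> simp

lemma torus_conj_opU (s : ℝ × ℝ) :
    torusUnitary s * opU * star (torusUnitary s) = (Circle.exp s.1 : ℂ) • opU := by
  simp only [torusUnitary, opU, star_weightedShift, weightedShift_mul, smul_weightedShift]
  congr 1
  funext p
  simp only [mul_one, ← Circle.exp_neg, ← Circle.exp_add]
  congr 1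
  simp
  ring

lemma torus_conj_opV (θ : ℝ) (s : ℝ × ℝ) :
    torusUnitary s * opV θ * star (torusUnitary s) = (Circle.exp s.2 : ℂ) • opV θ := by
  simp only [torusUnitary, opV, star_weightedShift, weightedShift_mul, smul_weightedShift]
  congr 1
  funext p
  rw [mul_right_comm, ← Circle.exp_neg, ← Circle.exp_add]
  congr 1
  · congr 1
    simp
    ring
  · simp

/-- The conjugation by the unitary `torusUnitary s`. -/
def torusConj (s : ℝ × ℝ) : (H0 →L[ℂ] H0) →⋆ₐ[ℂ] (H0 →L[ℂ] H0) :=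
  (Unitary.conjStarAlgAut ℂ (H0 →L[ℂ] H0)
    ⟨torusUnitary s, Unitary.mem_iff.mpr (torusUnitary_star s)⟩ :
      (H0 →L[ℂ] H0) ≃⋆ₐ[ℂ] (H0 →L[ℂ] H0)).toStarAlgHom

lemma torusConj_apply (s : ℝ × ℝ) (x : H0 →L[ℂ] H0) :
    torusConj s x = torusUnitary s * x * star (torusUnitary s) := rfl

lemma torusConj_mem (θ : ℝ) (s : ℝ × ℝ) {x : H0 →L[ℂ] H0} (hx : x ∈ rotationSubalgebra θ) :
    torusConj s x ∈ rotationSubalgebra θ := by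
  have hle : rotationSubalgebra θ ≤ (rotationSubalgebra θ).comap (torusConj s) := by
    refine rotationSubalgebra_le ?_ ?_ ?_
    · refine (rotationSubalgebra_isClosed θ).preimage (f := torusConj s) ?_
      change Continuous fun x => torusUnitary s * x * star (torusUnitary s)
      fun_prop
    · change torusConj s opU ∈ rotationSubalgebra θ
      rw [torusConj_apply, torus_conj_opU]
      exact SMulMemClass.smul_mem _ (opU_mem θ)
    · change torusConj s (opV θ) ∈ rotationSubalgebra θ
      rw [torusConj_apply, torus_conj_opV]
      exact SMulMemClass.smul_mem _ (opV_mem θ)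
  exact hle hx

/-- The automorphism `α_s` of `A_θ`, with `α_s (Uⁿ Vᵐ) = e^{i s·(n, m)} Uⁿ Vᵐ`. -/
def torusAction (θ : ℝ) (s : ℝ × ℝ) (x : RotationAlgebra θ) : RotationAlgebra θ :=
  ⟨torusConj s (toOp θ x), torusConj_mem θ s (toOp_mem x)⟩

/-- Membership in the smooth subalgebra `A_θ^∞`: the map `s ↦ α_s x` from `ℝ²` to `A_θ` is
smooth. -/
def IsSmooth {θ : ℝ} (x : RotationAlgebra θ) : Prop :=
  ContDiff ℝ ∞ (fun s : ℝ × ℝ => torusAction θ s x)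

/-! ## The trace -/

/-- The basis vector at `(0, 0)`, which stands for the unit of the algebra. -/
def vac : H0 := lp.single 2 (0 : ℤ × ℤ) (1 : ℂ)

/-- The trace `τ` of `A_θ`, i.e. the coefficient of `U⁰ V⁰`. -/
def tr (θ : ℝ) : RotationAlgebra θ →ₚ[ℂ] ℂ :=
  PositiveLinearMap.mk₀
    { toFun := fun a => ⟪vac, toOp θ a vac⟫_ℂ
      map_add' := fun a b => by simp
      map_smul' := fun z a => by simp } (fun a ha => by
    obtain ⟨b, rfl⟩ := CStarAlgebra.nonneg_iff_eq_star_mul_self.mp ha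
    change 0 ≤ ⟪vac, toOp θ (star b * b) vac⟫_ℂ
    rw [map_mul, map_star, mul_apply_eq_comp, ContinuousLinearMap.star_eq_adjoint,
      ContinuousLinearMap.adjoint_inner_right, inner_self_eq_norm_sq_to_K]
    positivity)

lemma tr_apply (θ : ℝ) (a : RotationAlgebra θ) : tr θ a = ⟪vac, toOp θ a vac⟫_ℂ := rfl

/-- Right multiplication by `U` on the basis `Uⁿ Vᵐ`. -/
def rightU (θ : ℝ) : H0 →L[ℂ] H0 := weightedShift (1, 0) (fun p => lam θ ^ p.2)

/-- Right multiplication by `V` on the basis `Uⁿ Vᵐ`. -/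
def rightV : H0 →L[ℂ] H0 := weightedShift (0, 1) (fun _ => 1)

lemma commute_right {θ : ℝ} {R a : H0 →L[ℂ] H0} (ha : a ∈ rotationSubalgebra θ)
    (hU : Commute opU R) (hU' : Commute opU (star R))
    (hV : Commute (opV θ) R) (hV' : Commute (opV θ) (star R)) : Commute a R := by
  have hle : rotationSubalgebra θ ≤ StarSubalgebra.centralizer ℂ {R} := by
    refine rotationSubalgebra_le ?_ ?_ ?_
    · rw [StarSubalgebra.coe_centralizer]
      exact Set.isClosed_centralizer _
    · rw [StarSubalgebra.mem_centralizer_iff]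
      rintro _ rfl
      exact ⟨hU.symm.eq, hU'.symm.eq⟩
    · rw [StarSubalgebra.mem_centralizer_iff]
      rintro _ rfl
      exact ⟨hV.symm.eq, hV'.symm.eq⟩
  exact ((StarSubalgebra.mem_centralizer_iff ℂ).mp (hle ha) R rfl).1.symm

lemma commute_rightU {θ : ℝ} {a : H0 →L[ℂ] H0} (ha : a ∈ rotationSubalgebra θ) :
    Commute a (rightU θ) := by
  refine commute_right ha ?_ ?_ ?_ ?_ <;>
  · simp only [rightU, opU, opV, star_weightedShift, Commute, SemiconjBy, weightedShift_mul]
    congr 1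
    funext p
    simp [zpow_sub, zpow_add, mul_comm, mul_left_comm, mul_assoc]

lemma commute_rightV {θ : ℝ} {a : H0 →L[ℂ] H0} (ha : a ∈ rotationSubalgebra θ) :
    Commute a rightV := by
  refine commute_right ha ?_ ?_ ?_ ?_ <;>
  · simp only [rightV, opU, opV, star_weightedShift, Commute, SemiconjBy, weightedShift_mul]
    congr 1
    try
      funext p
      simp

lemma weightedShift_vac (g : ℤ × ℤ) (c : ℤ × ℤ → Circle) :
    weightedShift g c vac = lp.single 2 g (c g : ℂ) := by
  ext p
  rw [weightedShift_apply, vac, lp.single_apply, lp.single_apply]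
  by_cases hp : p = g
  · subst hp
    simp
  · simp [hp, sub_eq_zero]

lemma tr_comm_aux {a R u : H0 →L[ℂ] H0} (hc : Commute a R) (h1 : u vac = R vac)
    (h2 : star u vac = star R vac) : ⟪vac, (u * a) vac⟫_ℂ = ⟪vac, (a * u) vac⟫_ℂ := by
  calc ⟪vac, u (a vac)⟫_ℂ = ⟪star u vac, a vac⟫_ℂ := by
        rw [ContinuousLinearMap.star_eq_adjoint, ContinuousLinearMap.adjoint_inner_left]
    _ = ⟪vac, R (a vac)⟫_ℂ := by
        rw [h2, ContinuousLinearMap.star_eq_adjoint, ContinuousLinearMap.adjoint_inner_left]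
    _ = ⟪vac, (R * a) vac⟫_ℂ := rfl
    _ = ⟪vac, (a * R) vac⟫_ℂ := by rw [hc.eq]
    _ = ⟪vac, a (R vac)⟫_ℂ := rfl
    _ = ⟪vac, a (u vac)⟫_ℂ := by rw [h1]

/-- The elements `x` of the algebra with `τ(x a) = τ(a x)` for all `a`. -/
def tracialSubalgebra (θ : ℝ) : StarSubalgebra ℂ (H0 →L[ℂ] H0) where
  carrier := {x | x ∈ rotationSubalgebra θ ∧
    ∀ a ∈ rotationSubalgebra θ, ⟪vac, (x * a) vac⟫_ℂ = ⟪vac, (a * x) vac⟫_ℂ}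
  mul_mem' := by
    rintro x y ⟨hx, hx'⟩ ⟨hy, hy'⟩
    refine ⟨mul_mem hx hy, fun a ha => ?_⟩
    rw [mul_assoc, hx' _ (mul_mem hy ha), mul_assoc, hy' _ (mul_mem ha hx), mul_assoc]
  add_mem' := by
    rintro x y ⟨hx, hx'⟩ ⟨hy, hy'⟩
    refine ⟨add_mem hx hy, fun a ha => ?_⟩
    rw [add_mul, mul_add, add_apply, add_apply,
      inner_add_right, inner_add_right, hx' a ha, hy' a ha]
  algebraMap_mem' := fun r => ⟨algebraMap_mem _ r, fun a _ => by rw [Algebra.commutes]⟩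
  star_mem' := by
    rintro x ⟨hx, hx'⟩
    refine ⟨star_mem hx, fun a ha => ?_⟩
    have h := congrArg star (hx' (star a) (star_mem ha))
    have key : ∀ y : H0 →L[ℂ] H0, star ⟪vac, y vac⟫_ℂ = ⟪vac, star y vac⟫_ℂ := fun y => by
      rw [ContinuousLinearMap.star_eq_adjoint, ContinuousLinearMap.adjoint_inner_right]
      exact inner_conj_symm _ _
    rw [key, key, star_mul, star_mul, star_star] at h
    exact h.symm

lemma rotationSubalgebra_le_tracial (θ : ℝ) : rotationSubalgebra θ ≤ tracialSubalgebra θ := by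
  refine rotationSubalgebra_le ?_ ⟨opU_mem θ, fun a ha => ?_⟩ ⟨opV_mem θ, fun a ha => ?_⟩
  · have h : (tracialSubalgebra θ : Set (H0 →L[ℂ] H0)) = (rotationSubalgebra θ : Set _) ∩
        ⋂ a ∈ rotationSubalgebra θ, {x | ⟪vac, (x * a) vac⟫_ℂ = ⟪vac, (a * x) vac⟫_ℂ} := by
      ext x
      simp [tracialSubalgebra]
    rw [h]
    refine (rotationSubalgebra_isClosed θ).inter (isClosed_biInter fun a _ => ?_)
    exact isClosed_eq (by fun_prop) (by fun_prop)
  · refine tr_comm_aux (commute_rightU ha) ?_ ?_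
    · simp [opU, rightU, weightedShift_vac]
    · simp [opU, rightU, star_weightedShift, weightedShift_vac]
  · refine tr_comm_aux (commute_rightV ha) ?_ ?_
    · simp [opV, rightV, weightedShift_vac]
    · simp [opV, rightV, star_weightedShift, weightedShift_vac]

lemma tr_mul_comm (θ : ℝ) (a b : RotationAlgebra θ) : tr θ (a * b) = tr θ (b * a) := by
  rw [tr_apply, tr_apply, map_mul, map_mul]
  exact (rotationSubalgebra_le_tracial θ (toOp_mem a)).2 _ (toOp_mem b)

/-! ## The weighted functional `φ` and the modular operator `Δ` -/

section Modular

open NormedSpace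

variable {θ : ℝ}

lemma exp_half_mul (h : RotationAlgebra θ) :
    exp ((1 / 2 : ℝ) • h) * exp ((1 / 2 : ℝ) • h) = exp h := by
  let : NormedAlgebra ℚ (RotationAlgebra θ) := NormedAlgebra.restrictScalars ℚ ℂ _
  rw [← exp_add_of_commute (Commute.refl _), ← add_smul]
  norm_num

/-- The positive functional `φ(a) = τ(a e^{-h})` on `A_θ`, for a self-adjoint `h`. -/
def phi (h : RotationAlgebra θ) (hh : IsSelfAdjoint h) : RotationAlgebra θ →ₚ[ℂ] ℂ :=
  PositiveLinearMap.mk₀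
    { toFun := fun a => tr θ (a * exp (-h))
      map_add' := fun a b => by rw [add_mul, map_add]
      map_smul' := fun z a => by rw [smul_mul_assoc, map_smul, RingHom.id_apply] } (fun a ha => by
    change 0 ≤ tr θ (a * exp (-h))
    have hq : IsSelfAdjoint (exp ((1 / 2 : ℝ) • (-h))) := by
      have := (IsSelfAdjoint.all (1 / 2 : ℝ)).smul hh.neg
      exact this.exp
    rw [← exp_half_mul (-h), ← mul_assoc, tr_mul_comm, ← mul_assoc]
    refine map_nonneg (tr θ) ?_
    exact hq.conjugate_nonneg ha)

lemma phi_apply (h : RotationAlgebra θ) (hh : IsSelfAdjoint h) (a : RotationAlgebra θ) :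
    phi h hh a = tr θ (a * exp (-h)) := rfl

lemma tr_star_mul_left_le (p y : RotationAlgebra θ) :
    tr θ (star (p * y) * (p * y)) ≤ (‖p‖ ^ 2 : ℝ) • tr θ (star y * y) := by
  have h : star y * star p * (p * y) ≤ ‖p‖ ^ 2 • star y * y := by
    rw [← mul_assoc, mul_assoc _ (star p), sq, ← CStarRing.norm_star_mul_self (x := p),
      smul_mul_assoc]
    exact CStarAlgebra.star_left_conjugate_le_norm_smul
  calc _ = tr θ (star y * star p * (p * y)) := by rw [star_mul]
    _ ≤ tr θ (‖p‖ ^ 2 • star y * y) := OrderHomClass.mono (tr θ) h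
    _ = _ := by
      rw [smul_mul_assoc, ← Complex.coe_smul, map_smul, Complex.coe_smul]

lemma tr_star_mul_conj_le (p y c : RotationAlgebra θ) :
    tr θ (star (p * y * c) * (p * y * c)) ≤ ((‖p‖ * ‖c‖) ^ 2 : ℝ) • tr θ (star y * y) := by
  have h1 : tr θ (star (y * c) * (y * c)) ≤ (‖c‖ ^ 2 : ℝ) • tr θ (star y * y) := by
    have := tr_star_mul_left_le (star c) (star y)
    rw [← star_mul, star_star, star_star, norm_star] at this
    rw [tr_mul_comm, tr_mul_comm _ (star y)]
    exact this
  calc _ = tr θ (star (p * (y * c)) * (p * (y * c))) := by rw [mul_assoc]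
    _ ≤ (‖p‖ ^ 2 : ℝ) • tr θ (star (y * c) * (y * c)) := tr_star_mul_left_le _ _
    _ ≤ (‖p‖ ^ 2 : ℝ) • ((‖c‖ ^ 2 : ℝ) • tr θ (star y * y)) :=
      smul_le_smul_of_nonneg_left h1 (by positivity)
    _ = _ := by rw [smul_smul, mul_pow]

lemma phi_star_mul_self (h : RotationAlgebra θ) (hh : IsSelfAdjoint h) (x : RotationAlgebra θ) :
    phi h hh (star x * x) =
      tr θ (star (x * exp ((1 / 2 : ℝ) • (-h))) * (x * exp ((1 / 2 : ℝ) • (-h)))) := by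
  have hq : IsSelfAdjoint (exp ((1 / 2 : ℝ) • (-h))) := by
    have := (IsSelfAdjoint.all (1 / 2 : ℝ)).smul hh.neg
    exact this.exp
  rw [phi_apply, ← exp_half_mul (-h), star_mul, hq.star_eq, ← mul_assoc, tr_mul_comm]
  simp only [mul_assoc]

lemma phi_conj_le (h : RotationAlgebra θ) (hh : IsSelfAdjoint h) (x : RotationAlgebra θ) :
    phi h hh (star (exp (-h) * x * exp h) * (exp (-h) * x * exp h)) ≤
      ((‖exp (-h)‖ * ‖exp h‖) ^ 2 : ℝ) • phi h hh (star x * x) := by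
  let : NormedAlgebra ℚ (RotationAlgebra θ) := NormedAlgebra.restrictScalars ℚ ℂ _
  rw [phi_star_mul_self, phi_star_mul_self]
  have hc : Commute (exp h) (exp ((1 / 2 : ℝ) • (-h))) :=
    Commute.exp (((Commute.refl h).neg_right).smul_right _)
  have : exp (-h) * x * exp h * exp ((1 / 2 : ℝ) • (-h)) =
      exp (-h) * (x * exp ((1 / 2 : ℝ) • (-h))) * exp h := by
    rw [mul_assoc, hc.eq]
    simp only [mul_assoc]
  rw [this]
  exact tr_star_mul_conj_le _ _ _

/-- The Hilbert space `H_φ`, the completion of `A_θ` for `⟨a, b⟩_φ = φ(b* a)`. -/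
abbrev Hphi (h : RotationAlgebra θ) (hh : IsSelfAdjoint h) : Type := (phi h hh).GNS

/-- The canonical map from `A_θ` to `H_φ`. -/
def toHphi (h : RotationAlgebra θ) (hh : IsSelfAdjoint h) (a : RotationAlgebra θ) : Hphi h hh :=
  ((phi h hh).toPreGNS a : (phi h hh).GNS)

/-- The map `x ↦ e^{-h} x e^h` on `A_θ` with the norm of `H_φ`. -/
def preModular (h : RotationAlgebra θ) (hh : IsSelfAdjoint h) :
    (phi h hh).PreGNS →L[ℂ] (phi h hh).PreGNS :=
  LinearMap.mkContinuous
    { toFun := fun x => (phi h hh).toPreGNS (exp (-h) * (phi h hh).ofPreGNS x * exp h)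
      map_add' := fun x y => by simp [mul_add, add_mul]
      map_smul' := fun z x => by simp } (‖exp (-h)‖ * ‖exp h‖) (fun x => by
    rw [← sq_le_sq₀ (by positivity) (by positivity), mul_pow, ← Complex.real_le_real,
      Complex.ofReal_mul, Complex.ofReal_pow, Complex.ofReal_pow ‖x‖,
      PositiveLinearMap.preGNS_norm_sq, PositiveLinearMap.preGNS_norm_sq]
    simpa using phi_conj_le h hh ((phi h hh).ofPreGNS x))

/-- The modular operator `Δ` of `φ`, the bounded operator on `H_φ` extending
`x ↦ e^{-h} x e^h`. -/
def modularOp (h : RotationAlgebra θ) (hh : IsSelfAdjoint h) : Hphi h hh →L[ℂ] Hphi h hh :=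
  (preModular h hh).completion

lemma modularOp_toHphi (h : RotationAlgebra θ) (hh : IsSelfAdjoint h) (x : RotationAlgebra θ) :
    modularOp h hh (toHphi h hh x) = toHphi h hh (exp (-h) * x * exp h) := by
  simp [modularOp, toHphi, preModular]

/-- The Weyl factor `k = e^{h/2}`. -/
def weyl (h : RotationAlgebra θ) : RotationAlgebra θ := exp ((1 / 2 : ℝ) • h)

/-- The integrand `k^{2m+2} u^m (k² u + 1)^{-(m+1)} ρ (k² u + 1)^{-1}`. -/
def moveIntegrand (h : RotationAlgebra θ) (m : ℕ) (ρ : RotationAlgebra θ) (u : ℝ) :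
    RotationAlgebra θ :=
  (u ^ m) • (weyl h ^ (2 * m + 2) * Ring.inverse ((u • weyl h ^ 2 + 1) ^ (m + 1)) * ρ *
    Ring.inverse (u • weyl h ^ 2 + 1))

end Modular

/-! ## The modified logarithm -/

/-- The integrand `x^m (x+1)^{-(m+1)} (x u + 1)^{-1}`. -/
def modLogIntegrand (m : ℕ) (u x : ℝ) : ℝ :=
  x ^ m / (x + 1) ^ (m + 1) * (1 / (x * u + 1))

/-- The function `𝓛_m(u) = ∫₀^∞ x^m (x+1)^{-(m+1)} (x u + 1)^{-1} dx`. -/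
def modLog (m : ℕ) (u : ℝ) : ℝ := ∫ x in Set.Ioi (0 : ℝ), modLogIntegrand m u x

end NCTorus

end

open NCTorus

/-!
Write `K = k² = e^h`. On `H_φ` let `L` and `R` be the multiplications by `K` on the left and on the
right. Both are self-adjoint for `⟨a, b⟩ = τ(b* a e^{-h})`, since `τ` is a trace and `K` commutes
with `e^{-h}`, and both are squares of invertible self-adjoint operators (the multiplications by
`k`), so their spectra lie in `(0, ∞)`. They commute, and `Δ = L⁻¹ R`. The integrand of the
rearrangement formula, as a vector of `H_φ`, is
`u^m L^{m+1} (u L + 1)^{-(m+1)} (u R + 1)⁻¹` applied to `ρ` (`toHphi_rearrIntegrand`).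

So the formula is a statement on two commuting positive operators `L` and `Δ`, with `R = L Δ`
(`integral_rearrIntegrand_of_commute`). In the commutative C*-algebra that they generate, it can be
tested on characters. A character sends `L` and `Δ` to positive numbers `r` and `t`, and the formula
becomes `∫ u^m r^{m+1} (u r + 1)^{-(m+1)} (u r t + 1)⁻¹ du = 𝓛_m(t)`, which is the substitution
`x = r u` (`integral_eq_modLog_div`). Norm convergence holds because the functional calculus bounds
the integrand by a multiple of `(c u + 1)⁻²`, where `c > 0` is a lower bound of the spectra
(`norm_rearrIntegrand_le`).

The closed form of `𝓛_m` follows by induction on `m` from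
`(u - 1) 𝓛_{m+1}(u) = 1 / (m + 1) - 𝓛_m(u)` (`modLog_succ`). The map `A_θ → H_φ` is injective
because `τ` is faithful: the vacuum vector is cyclic for the right multiplications, which commute
with `A_θ` (`eq_zero_of_apply_vac`).
-/

namespace NCTorus

open MeasureTheory Set Filter Topology NormedSpace
open scoped InnerProductSpace ComplexOrder

/-! ### The modified logarithm on `(0, ∞)` -/

lemma integrableOn_inv_sq {c : ℝ} (hc : 0 < c) :
    IntegrableOn (fun x : ℝ => ((c * x + 1) ^ 2)⁻¹) (Ioi 0) := by
  have hpos : ∀ x ∈ Ici (0 : ℝ), 0 < c * x + 1 := fun x hx => by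
    have := mul_nonneg hc.le (mem_Ici.mp hx)
    positivity
  refine integrableOn_Ioi_deriv_of_nonneg' (g := fun x => -(c * (c * x + 1))⁻¹) (l := -0)
    (fun x hx => ?_) (fun x hx => by positivity) ?_
  · have h := hpos x hx
    have h1 : HasDerivAt (fun x : ℝ => c * (c * x + 1)) (c * (c * 1)) x :=
      (((hasDerivAt_id x).const_mul c).add_const 1).const_mul c
    refine ((h1.inv (by positivity)).neg).congr_deriv ?_
    field_simp
  · refine Tendsto.neg (tendsto_inv_atTop_zero.comp ?_)
    exact (tendsto_atTop_add_const_right _ _ (tendsto_id.const_mul_atTop hc)).const_mul_atTop hc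

lemma modLogIntegrand_nonneg {m : ℕ} {u x : ℝ} (hu : 0 < u) (hx : 0 < x) :
    0 ≤ modLogIntegrand m u x := by
  unfold modLogIntegrand
  positivity

/-- A bound that is uniform in `u ≥ c`, which serves both integrability and continuity in `u`. -/
lemma modLogIntegrand_le {m : ℕ} {c u x : ℝ} (hc : 0 < c) (hc1 : c ≤ 1) (hcu : c ≤ u)
    (hx : 0 < x) : modLogIntegrand m u x ≤ ((c * x + 1) ^ 2)⁻¹ := by
  have hu : 0 < u := hc.trans_le hcu
  have h1 : x ^ m / (x + 1) ^ (m + 1) ≤ (c * x + 1)⁻¹ := by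
    calc x ^ m / (x + 1) ^ (m + 1) ≤ (x + 1) ^ m / (x + 1) ^ (m + 1) := by
          gcongr
          linarith
      _ = (x + 1)⁻¹ := by
          rw [pow_succ]
          field_simp
      _ ≤ (c * x + 1)⁻¹ := by
          gcongr
          nlinarith
  have h2 : 1 / (x * u + 1) ≤ (c * x + 1)⁻¹ := by
    rw [one_div, mul_comm x]
    gcongr
  calc modLogIntegrand m u x ≤ (c * x + 1)⁻¹ * (c * x + 1)⁻¹ := by
        unfold modLogIntegrand
        gcongr
    _ = _ := by rw [sq, mul_inv]

lemma continuousOn_modLogIntegrand (m : ℕ) {u : ℝ} (hu : 0 < u) :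
    ContinuousOn (modLogIntegrand m u) (Ioi 0) := by
  unfold modLogIntegrand
  refine ContinuousOn.mul (ContinuousOn.div (by fun_prop) (by fun_prop) fun x hx => ?_)
    (ContinuousOn.div (by fun_prop) (by fun_prop) fun x hx => ?_)
  all_goals
    have : 0 < x := hx
    positivity

lemma aestronglyMeasurable_modLogIntegrand (m : ℕ) {u : ℝ} (hu : 0 < u) :
    AEStronglyMeasurable (modLogIntegrand m u) (volume.restrict (Ioi 0)) :=
  (continuousOn_modLogIntegrand m hu).aestronglyMeasurable measurableSet_Ioi

lemma norm_modLogIntegrand_le_ae (m : ℕ) {c u : ℝ} (hc : 0 < c) (hc1 : c ≤ 1) (hcu : c ≤ u) :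
    ∀ᵐ x ∂volume.restrict (Ioi (0 : ℝ)), ‖modLogIntegrand m u x‖ ≤ ((c * x + 1) ^ 2)⁻¹ := by
  refine (ae_restrict_iff' measurableSet_Ioi).mpr (ae_of_all _ fun x hx => ?_)
  rw [Real.norm_of_nonneg (modLogIntegrand_nonneg (hc.trans_le hcu) hx)]
  exact modLogIntegrand_le hc hc1 hcu hx

lemma integrableOn_modLogIntegrand (m : ℕ) {u : ℝ} (hu : 0 < u) :
    IntegrableOn (modLogIntegrand m u) (Ioi 0) :=
  Integrable.mono' (integrableOn_inv_sq (lt_min one_pos hu))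
    (aestronglyMeasurable_modLogIntegrand m hu)
    (norm_modLogIntegrand_le_ae m (lt_min one_pos hu) (min_le_left _ _) (min_le_right _ _))

lemma continuousOn_modLog (m : ℕ) : ContinuousOn (modLog m) (Ioi 0) := by
  intro u hu
  have hu : 0 < u := hu
  set c := min 1 (u / 2)
  have hc : 0 < c := lt_min one_pos (half_pos hu)
  have hcu : c < u := (min_le_right _ _).trans_lt (half_lt_self hu)
  refine ((continuousOn_of_dominated (s := Ici c) (F := modLogIntegrand m)
    (bound := fun x => ((c * x + 1) ^ 2)⁻¹)
    (fun v hv => aestronglyMeasurable_modLogIntegrand m (hc.trans_le hv))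
    (fun v hv => norm_modLogIntegrand_le_ae m hc (min_le_left _ _) hv)
    (integrableOn_inv_sq hc) ?_).continuousAt (Ici_mem_nhds hcu)).continuousWithinAt
  refine (ae_restrict_iff' measurableSet_Ioi).mpr (ae_of_all _ fun x hx => ?_)
  have hx : 0 < x := hx
  unfold modLogIntegrand
  refine ContinuousOn.mul (by fun_prop) (ContinuousOn.div (by fun_prop) (by fun_prop) ?_)
  intro v hv
  have : 0 < v := hc.trans_le hv
  positivity

/-- The integrand of `𝓛₀` has the antiderivative `(u - 1)⁻¹ log ((x u + 1) / (x + 1))`. -/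
lemma modLog_zero {u : ℝ} (hu : 0 < u) (hu1 : u ≠ 1) : modLog 0 u = (u - 1)⁻¹ * Real.log u := by
  have hw : u - 1 ≠ 0 := sub_ne_zero.mpr hu1
  have key := integral_Ioi_of_hasDerivAt_of_tendsto' (a := 0) (f' := modLogIntegrand 0 u)
    (f := fun x : ℝ => (u - 1)⁻¹ * Real.log ((x * u + 1) / (x + 1)))
    (m := (u - 1)⁻¹ * Real.log u) ?_ (integrableOn_modLogIntegrand 0 hu) ?_
  · simpa [modLog] using key
  · intro x hx
    have hx : 0 ≤ x := hx
    have h1 : x * u + 1 ≠ 0 := by positivity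
    have h2 : x + 1 ≠ 0 := by positivity
    have hd : HasDerivAt (fun x : ℝ => (x * u + 1) / (x + 1))
        (((1 * u) * (x + 1) - (x * u + 1) * 1) / (x + 1) ^ 2) x :=
      (((hasDerivAt_id x).mul_const u).add_const 1).div ((hasDerivAt_id x).add_const 1) h2
    refine ((hd.log (div_ne_zero h1 h2)).const_mul (u - 1)⁻¹).congr_deriv ?_
    unfold modLogIntegrand
    field_simp
    ring
  · refine Tendsto.const_mul _ (((Real.continuousAt_log hu.ne').tendsto).comp ?_)
    have h1 : Tendsto (fun x : ℝ => u + (1 - u) * (x + 1)⁻¹) atTop (𝓝 (u + (1 - u) * 0)) :=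
      tendsto_const_nhds.add ((tendsto_inv_atTop_zero.comp
        (tendsto_atTop_add_const_right _ _ tendsto_id)).const_mul _)
    rw [mul_zero, add_zero] at h1
    refine h1.congr' ?_
    filter_upwards [eventually_gt_atTop 0] with x hx
    field_simp
    ring

lemma hasDerivAt_div_add_one_pow (m : ℕ) {x : ℝ} (hx : 0 ≤ x) :
    HasDerivAt (fun x : ℝ => (x / (x + 1)) ^ (m + 1) / (m + 1)) (x ^ m / (x + 1) ^ (m + 2)) x := by
  have h2 : x + 1 ≠ 0 := by positivity
  have hd : HasDerivAt (fun x : ℝ => x / (x + 1)) ((1 * (x + 1) - x * 1) / (x + 1) ^ 2) x :=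
    (hasDerivAt_id x).div ((hasDerivAt_id x).add_const 1) h2
  refine ((hd.pow (m + 1)).div_const (m + 1 : ℝ)).congr_deriv ?_
  push_cast
  rw [div_pow]
  field_simp
  ring

lemma tendsto_div_add_one_pow (m : ℕ) :
    Tendsto (fun x : ℝ => (x / (x + 1)) ^ (m + 1) / (m + 1)) atTop (𝓝 (1 / (m + 1))) := by
  have h1 : Tendsto (fun x : ℝ => 1 - (x + 1)⁻¹) atTop (𝓝 (1 - 0)) :=
    tendsto_const_nhds.sub (tendsto_inv_atTop_zero.comp
      (tendsto_atTop_add_const_right _ _ tendsto_id))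
  have h2 : Tendsto (fun x : ℝ => x / (x + 1)) atTop (𝓝 1) := by
    rw [sub_zero] at h1
    refine h1.congr' ?_
    filter_upwards [eventually_gt_atTop 0] with x hx
    field_simp
    ring
  simpa using (h2.pow (m + 1)).div_const (m + 1 : ℝ)

/-- Since `x (u - 1) = (x u + 1) - (x + 1)`, one partial fraction step lowers `m` by one. -/
lemma modLog_succ (m : ℕ) {u : ℝ} (hu : 0 < u) :
    (u - 1) * modLog (m + 1) u = 1 / (m + 1) - modLog m u := by
  have hint := integrableOn_Ioi_deriv_of_nonneg' (a := 0)
    (fun x hx => hasDerivAt_div_add_one_pow m hx)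
    (fun x hx => by have : 0 < x := hx; positivity) (tendsto_div_add_one_pow m)
  have hval := integral_Ioi_of_hasDerivAt_of_tendsto' (a := 0)
    (fun x hx => hasDerivAt_div_add_one_pow m hx) hint (tendsto_div_add_one_pow m)
  rw [zero_div, zero_pow m.succ_ne_zero, zero_div, sub_zero] at hval
  rw [← hval, modLog, modLog, ← integral_const_mul,
    ← integral_sub hint (integrableOn_modLogIntegrand m hu)]
  refine setIntegral_congr_fun measurableSet_Ioi fun x hx => ?_
  have hx : 0 < x := hx
  simp only [modLogIntegrand]
  field_simp
  ring

lemma modLog_eq (m : ℕ) {u : ℝ} (hu : 0 < u) (hu1 : u ≠ 1) :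
    modLog m u = (-1) ^ m * ((u - 1) ^ (m + 1))⁻¹ *
      (Real.log u - ∑ j ∈ Finset.Icc 1 m, (-1) ^ (j + 1) * (u - 1) ^ j / (j : ℝ)) := by
  have hw : u - 1 ≠ 0 := sub_ne_zero.mpr hu1
  induction m with
  | zero => simpa using modLog_zero hu hu1
  | succ m ih =>
    rw [← mul_right_inj' hw, modLog_succ m hu, ih, Finset.sum_Icc_succ_top (by omega)]
    push_cast
    have hs : ((-1 : ℝ) ^ m) * (-1) ^ m = 1 := by rw [← mul_pow]; simp
    simp only [pow_succ]
    field_simp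
    linear_combination (-(u - 1) ^ m * (u - 1)) * hs

/-- The substitution `x = a u` in the integral that defines `𝓛_m (b / a)`. -/
lemma integral_eq_modLog_div (m : ℕ) {a b : ℝ} (ha : 0 < a) :
    ∫ u in Ioi (0 : ℝ), u ^ m * (a ^ (m + 1) * ((u * a + 1) ^ (m + 1))⁻¹ * (u * b + 1)⁻¹) =
      modLog m (a⁻¹ * b) := by
  have h := integral_comp_mul_left_Ioi' (modLogIntegrand m (a⁻¹ * b)) 0 ha
  rw [mul_zero] at h
  rw [modLog, ← h, ← integral_smul]
  congr 1 with u
  have : a * u * (a⁻¹ * b) = u * b := by field_simp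
  simp only [modLogIntegrand, this, smul_eq_mul, mul_pow]
  rw [mul_comm a u]
  ring

/-! ### The rearranged integrand in a C*-algebra -/

lemma map_ringInverse_of_isUnit {M N F : Type*} [MonoidWithZero M] [MonoidWithZero N]
    [FunLike F M N] [MonoidHomClass F M N] (f : F) {x : M} (hx : IsUnit x) :
    f (Ring.inverse x) = Ring.inverse (f x) := by
  obtain ⟨x, rfl⟩ := hx
  rw [Ring.inverse_unit]
  exact (Ring.inverse_unit (Units.map (f : M →* N) x)).symm

section CStar

variable {A : Type*} [CStarAlgebra A]

/-- The element `u^m a^{m+1} (u a + 1)^{-(m+1)} ρ (u b + 1)^{-1}` of a C*-algebra. -/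
noncomputable def rearrIntegrand (m : ℕ) (a b ρ : A) (u : ℝ) : A :=
  (u ^ m) • (a ^ (m + 1) * Ring.inverse ((u • a + 1) ^ (m + 1)) * ρ * Ring.inverse (u • b + 1))

lemma smul_add_one_eq_cfc {a : A} (ha : IsSelfAdjoint a) (u : ℝ) :
    u • a + 1 = cfc (fun x : ℝ => u * x + 1) a := by
  rw [cfc_add_const (1 : ℝ) (fun x => u * x) a, cfc_const_mul_id u a, map_one]

lemma isUnit_smul_add_one {a : A} (ha : IsSelfAdjoint a) (hs : spectrum ℝ a ⊆ Ioi 0) {u : ℝ}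
    (hu : 0 ≤ u) : IsUnit (u • a + 1) := by
  rw [smul_add_one_eq_cfc ha, isUnit_cfc_iff (fun x : ℝ => u * x + 1) a]
  intro x hx
  have : 0 < x := hs hx
  positivity

lemma ringInverse_smul_add_one {a : A} (ha : IsSelfAdjoint a) (hs : spectrum ℝ a ⊆ Ioi 0) {u : ℝ}
    (hu : 0 ≤ u) : Ring.inverse (u • a + 1) = cfc (fun x : ℝ => (u * x + 1)⁻¹) a := by
  rw [smul_add_one_eq_cfc ha, cfc_inv (fun x : ℝ => u * x + 1) a]
  intro x hx
  have : 0 < x := hs hx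
  positivity

lemma pow_mul_ringInverse_pow {a : A} (ha : IsSelfAdjoint a) (hs : spectrum ℝ a ⊆ Ioi 0) {u : ℝ}
    (hu : 0 ≤ u) (n : ℕ) : a ^ n * Ring.inverse ((u • a + 1) ^ n) =
      cfc (fun x : ℝ => x ^ n * ((u * x + 1)⁻¹) ^ n) a := by
  have hne : ∀ x ∈ spectrum ℝ a, u * x + 1 ≠ 0 := fun x hx => by
    have : 0 < x := hs hx
    positivity
  have hc : ContinuousOn (fun x : ℝ => (u * x + 1)⁻¹) (spectrum ℝ a) :=
    ContinuousOn.inv₀ (by fun_prop) hne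
  rw [cfc_mul (fun x : ℝ => x ^ n) (fun x : ℝ => ((u * x + 1)⁻¹) ^ n) a (by fun_prop) (hc.pow n),
    cfc_pow_id a n, cfc_pow (fun x : ℝ => (u * x + 1)⁻¹) n a hc, ← ringInverse_smul_add_one ha hs hu,
    Ring.inverse_pow]

/-- The bound exists because the spectrum is compact. -/
lemma exists_pos_le_spectrum {a : A} (hs : spectrum ℝ a ⊆ Ioi 0) :
    ∃ c : ℝ, 0 < c ∧ ∀ x ∈ spectrum ℝ a, c ≤ x := by
  -- the spectrum is empty in the zero algebra, where every bound will do
  rcases (spectrum ℝ a).eq_empty_or_nonempty with h | h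
  · exact ⟨1, one_pos, by simp [h]⟩
  · obtain ⟨c, hc, hmin⟩ :=
      (spectrum.isCompact (𝕜 := ℝ) a).exists_isMinOn h continuousOn_id
    exact ⟨c, hs hc, fun x hx => hmin hx⟩

lemma continuousOn_rearrIntegrand (m : ℕ) {a b : A} (ha : IsSelfAdjoint a)
    (has : spectrum ℝ a ⊆ Ioi 0) (hb : IsSelfAdjoint b) (hbs : spectrum ℝ b ⊆ Ioi 0) (ρ : A) :
    ContinuousOn (rearrIntegrand m a b ρ) (Ioi 0) := by
  have hinv : ∀ (n : ℕ) {x : A}, IsSelfAdjoint x → spectrum ℝ x ⊆ Ioi 0 →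
      ContinuousOn (fun u : ℝ => Ring.inverse ((u • x + 1) ^ n)) (Ioi 0) := by
    intro n x hx hxs u hu
    have hunit : IsUnit ((u • x + 1) ^ n) := (isUnit_smul_add_one hx hxs (le_of_lt hu)).pow n
    have h1 : ContinuousAt Ring.inverse ((u • x + 1) ^ n) :=
      NormedRing.inverse_continuousAt hunit.unit
    exact (ContinuousAt.comp (f := fun u : ℝ => (u • x + 1) ^ n) h1
      (by fun_prop)).continuousWithinAt
  have h1 := hinv (m + 1) ha has
  have h2 := hinv 1 hb hbs
  simp only [pow_one] at h2
  unfold rearrIntegrand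
  fun_prop

/-- The left factor is the value at `a` of the function `x (u x + 1)⁻¹ (u x / (u x + 1))^m`, where
the last factor is at most one. -/
lemma norm_rearrIntegrand_le (m : ℕ) {a b : A} (ha : IsSelfAdjoint a)
    (has : spectrum ℝ a ⊆ Ioi 0) (hb : IsSelfAdjoint b) (hbs : spectrum ℝ b ⊆ Ioi 0) (ρ : A)
    {c u : ℝ} (hc : 0 < c) (hac : ∀ x ∈ spectrum ℝ a, c ≤ x) (hbc : ∀ x ∈ spectrum ℝ b, c ≤ x)
    (hu : 0 < u) : ‖rearrIntegrand m a b ρ u‖ ≤ ‖a‖ * ‖ρ‖ * ((c * u + 1) ^ 2)⁻¹ := by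
  have h1 : ‖(u ^ m) • (a ^ (m + 1) * Ring.inverse ((u • a + 1) ^ (m + 1)))‖ ≤
      ‖a‖ * (c * u + 1)⁻¹ := by
    rw [norm_smul, Real.norm_of_nonneg (by positivity), pow_mul_ringInverse_pow ha has hu.le]
    suffices ‖cfc (fun x : ℝ => x ^ (m + 1) * ((u * x + 1)⁻¹) ^ (m + 1)) a‖ ≤
        (u ^ m)⁻¹ * (‖a‖ * (c * u + 1)⁻¹) by
      rwa [le_inv_mul_iff₀ (by positivity)] at this
    refine norm_cfc_le (by positivity) fun x hx => ?_
    have hx0 : 0 < x := has hx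
    have hxa : x ≤ ‖a‖ := (Real.le_norm_self x).trans
      (IsometricContinuousFunctionalCalculus.norm_spectrum_le a hx)
    rw [Real.norm_of_nonneg (by positivity), le_inv_mul_iff₀ (by positivity)]
    calc u ^ m * (x ^ (m + 1) * ((u * x + 1)⁻¹) ^ (m + 1))
        = (u * x / (u * x + 1)) ^ m * (x * (u * x + 1)⁻¹) := by
          rw [div_pow, mul_pow, inv_pow, pow_succ, pow_succ]
          field_simp
      _ ≤ 1 ^ m * (‖a‖ * (u * c + 1)⁻¹) := by
          gcongr
          · rw [div_le_one (by positivity)]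
            linarith
          · exact hac x hx
      _ = _ := by rw [one_pow, one_mul, mul_comm u c]
  have h2 : ‖Ring.inverse (u • b + 1)‖ ≤ (c * u + 1)⁻¹ := by
    rw [ringInverse_smul_add_one hb hbs hu.le]
    refine norm_cfc_le (by positivity) fun x hx => ?_
    have hx0 : 0 < x := hbs hx
    rw [Real.norm_of_nonneg (by positivity), mul_comm c]
    gcongr
    exact hbc x hx
  calc ‖rearrIntegrand m a b ρ u‖
      = ‖(u ^ m) • (a ^ (m + 1) * Ring.inverse ((u • a + 1) ^ (m + 1))) * ρ *
          Ring.inverse (u • b + 1)‖ := by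
        rw [rearrIntegrand, smul_mul_assoc, smul_mul_assoc]
    _ ≤ ‖a‖ * (c * u + 1)⁻¹ * ‖ρ‖ * (c * u + 1)⁻¹ := by
        refine (norm_mul_le _ _).trans ?_
        gcongr
        refine (norm_mul_le _ _).trans ?_
        gcongr
    _ = _ := by
        rw [sq, mul_inv]
        ring

lemma integrableOn_rearrIntegrand (m : ℕ) {a b : A} (ha : IsSelfAdjoint a)
    (has : spectrum ℝ a ⊆ Ioi 0) (hb : IsSelfAdjoint b) (hbs : spectrum ℝ b ⊆ Ioi 0) (ρ : A) :
    IntegrableOn (rearrIntegrand m a b ρ) (Ioi 0) := by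
  obtain ⟨c, hc, hac⟩ := exists_pos_le_spectrum has
  obtain ⟨d, hd, hbd⟩ := exists_pos_le_spectrum hbs
  have hcd : 0 < min c d := lt_min hc hd
  refine Integrable.mono' ((integrableOn_inv_sq hcd).const_mul (‖a‖ * ‖ρ‖))
    ((continuousOn_rearrIntegrand m ha has hb hbs ρ).aestronglyMeasurable measurableSet_Ioi)
    ((ae_restrict_iff' measurableSet_Ioi).mpr (ae_of_all _ fun u hu => ?_))
  exact norm_rearrIntegrand_le m ha has hb hbs ρ hcd (fun x hx => (min_le_left _ _).trans (hac x hx))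
    (fun x hx => (min_le_right _ _).trans (hbd x hx)) hu

lemma spectrum_mul_self_pos {s : A} (hs : IsSelfAdjoint s) (hu : IsUnit s) :
    spectrum ℝ (s * s) ⊆ Ioi 0 := by
  have h := cfc_map_spectrum (fun x : ℝ => x ^ 2) s
  rw [cfc_pow_id s 2, sq] at h
  rw [h]
  rintro _ ⟨x, hx, rfl⟩
  have : x ≠ 0 := fun h0 => spectrum.zero_notMem ℝ hu (h0 ▸ hx)
  exact mem_Ioi.mpr (by positivity)

end CStar

section Comm

open WeakDual

variable {B : Type*} [CommCStarAlgebra B]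

lemma exists_character_eq_ofReal (χ : characterSpace ℂ B) {a : B} (ha : IsSelfAdjoint a)
    (has : spectrum ℝ a ⊆ Ioi 0) : ∃ r : ℝ, 0 < r ∧ χ a = (r : ℂ) := by
  have h := AlgHom.apply_mem_spectrum χ a
  have hre := ha.mem_spectrum_eq_re h
  refine ⟨(χ a).re, has ?_, hre⟩
  rw [← spectrum.preimage_algebraMap ℂ]
  change ((χ a).re : ℂ) ∈ spectrum ℂ a
  rwa [← hre]

lemma spectrum_mul_pos {a d : B} (ha : IsSelfAdjoint a) (has : spectrum ℝ a ⊆ Ioi 0)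
    (hd : IsSelfAdjoint d) (hds : spectrum ℝ d ⊆ Ioi 0) : spectrum ℝ (a * d) ⊆ Ioi 0 := by
  intro x hx
  rw [← spectrum.preimage_algebraMap ℂ] at hx
  obtain ⟨χ, hχ⟩ := CharacterSpace.mem_spectrum_iff_exists.mp (mem_preimage.mp hx)
  obtain ⟨r, hr, hra⟩ := exists_character_eq_ofReal χ ha has
  obtain ⟨t, ht, htd⟩ := exists_character_eq_ofReal χ hd hds
  rw [map_mul, hra, htd, Complex.coe_algebraMap, ← Complex.ofReal_mul, Complex.ofReal_inj] at hχ
  exact hχ ▸ mem_Ioi.mpr (mul_pos hr ht)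

lemma character_cfc (χ : characterSpace ℂ B) {d : B} (hd : IsSelfAdjoint d) {f : ℝ → ℝ}
    (hf : ContinuousOn f (spectrum ℝ d)) {r : ℝ} (hr : χ d = (r : ℂ)) :
    χ (cfc f d) = (f r : ℂ) := by
  have hsa : IsSelfAdjoint (χ d) := by
    rw [hr]
    exact Complex.conj_ofReal r
  have h := StarAlgHomClass.map_cfc (S := ℂ) χ f d hf (map_continuous χ) hd hsa
  rw [h, hr]
  exact cfc_algebraMap (A := ℂ) r f

lemma character_rearrIntegrand (χ : characterSpace ℂ B) (m : ℕ) {a b : B} (ha : IsSelfAdjoint a)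
    (has : spectrum ℝ a ⊆ Ioi 0) (hb : IsSelfAdjoint b) (hbs : spectrum ℝ b ⊆ Ioi 0)
    {r t u : ℝ} (hr : χ a = (r : ℂ)) (ht : χ b = (t : ℂ)) (hu : 0 < u) :
    χ (rearrIntegrand m a b 1 u) =
      ((u ^ m * (r ^ (m + 1) * ((u * r + 1) ^ (m + 1))⁻¹ * (u * t + 1)⁻¹) : ℝ) : ℂ) := by
  have hsmul : ∀ (v : ℝ) (x : B), χ (v • x) = (v : ℂ) * χ x := fun v x => by
    rw [← Complex.coe_smul, map_smul, smul_eq_mul]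
  rw [rearrIntegrand, hsmul, mul_one, map_mul, map_mul, map_pow,
    map_ringInverse_of_isUnit χ ((isUnit_smul_add_one ha has hu.le).pow _),
    map_ringInverse_of_isUnit χ (isUnit_smul_add_one hb hbs hu.le), map_pow, map_add, map_add,
    hsmul, hsmul, map_one, hr, ht, Ring.inverse_eq_inv, Ring.inverse_eq_inv]
  push_cast
  ring

/-- Both sides have the same value at each character, by the scalar substitution
`integral_eq_modLog_div`, and the characters separate the points of `B`. -/
lemma integral_rearrIntegrand_comm (m : ℕ) {a d : B} (ha : IsSelfAdjoint a)
    (has : spectrum ℝ a ⊆ Ioi 0) (hd : IsSelfAdjoint d) (hds : spectrum ℝ d ⊆ Ioi 0) :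
    ∫ u in Ioi (0 : ℝ), rearrIntegrand m a (a * d) 1 u = cfc (modLog m) d := by
  have hb : IsSelfAdjoint (a * d) := (IsSelfAdjoint.commute_iff ha hd).mp (mul_comm a d)
  have hbs := spectrum_mul_pos ha has hd hds
  refine (gelfandTransform_bijective B).1 (ContinuousMap.ext fun χ => ?_)
  obtain ⟨r, hr, hra⟩ := exists_character_eq_ofReal χ ha has
  obtain ⟨t, ht, htd⟩ := exists_character_eq_ofReal χ hd hds
  have hχb : χ (a * d) = ((r * t : ℝ) : ℂ) := by rw [map_mul, hra, htd, Complex.ofReal_mul]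
  change χ (∫ u in Ioi (0 : ℝ), rearrIntegrand m a (a * d) 1 u) = χ (cfc (modLog m) d)
  rw [character_cfc χ hd ((continuousOn_modLog m).mono hds) htd]
  have h1 := (CharacterSpace.toCLM χ).integral_comp_comm
    (integrableOn_rearrIntegrand m ha has hb hbs 1)
  refine h1.symm.trans ?_
  refine (setIntegral_congr_fun (g := fun u : ℝ => ((u ^ m * (r ^ (m + 1) *
    ((u * r + 1) ^ (m + 1))⁻¹ * (u * (r * t) + 1)⁻¹) : ℝ) : ℂ)) measurableSet_Ioi
    fun u hu => character_rearrIntegrand χ m ha has hb hbs hra hχb hu).trans ?_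
  rw [integral_complex_ofReal, integral_eq_modLog_div m hr, inv_mul_cancel_left₀ hr.ne']

end Comm

/-! ### Commuting positive elements -/

section Commuting

variable {A : Type*} [CStarAlgebra A]

lemma map_rearrIntegrand {B : Type*} [CStarAlgebra B] (f : B →⋆ₐ[ℂ] A) (m : ℕ) {a b : B}
    (ha : IsSelfAdjoint a) (has : spectrum ℝ a ⊆ Ioi 0) (hb : IsSelfAdjoint b)
    (hbs : spectrum ℝ b ⊆ Ioi 0) (ρ : B) {u : ℝ} (hu : 0 < u) :
    f (rearrIntegrand m a b ρ u) = rearrIntegrand m (f a) (f b) (f ρ) u := by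
  have hsmul : ∀ (v : ℝ) (x : B), f (v • x) = v • f x := fun v x => by
    rw [← Complex.coe_smul, map_smul, Complex.coe_smul]
  rw [rearrIntegrand, hsmul, map_mul, map_mul, map_mul, map_pow,
    map_ringInverse_of_isUnit f ((isUnit_smul_add_one ha has hu.le).pow _),
    map_ringInverse_of_isUnit f (isUnit_smul_add_one hb hbs hu.le), map_pow, map_add, map_add,
    hsmul, hsmul, map_one, rearrIntegrand]

lemma spectrum_real_coe {S : StarSubalgebra ℂ A} [IsClosed (S : Set A)] (x : S) :
    spectrum ℝ x = spectrum ℝ (x : A) := by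
  rw [← spectrum.preimage_algebraMap ℂ (a := x), ← spectrum.preimage_algebraMap ℂ (a := (x : A)),
    StarSubalgebra.spectrum_eq S]

/-- The case of a commutative algebra applies to the closed star subalgebra generated by the
commuting self-adjoint elements `a` and `d`, where the spectra are the same. -/
theorem integral_rearrIntegrand_of_commute (m : ℕ) {a d : A} (ha : IsSelfAdjoint a)
    (has : spectrum ℝ a ⊆ Ioi 0) (hd : IsSelfAdjoint d) (hds : spectrum ℝ d ⊆ Ioi 0)
    (had : Commute a d) :
    IntegrableOn (rearrIntegrand m a (a * d) 1) (Ioi 0) ∧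
      ∫ u in Ioi (0 : ℝ), rearrIntegrand m a (a * d) 1 u = cfc (modLog m) d := by
  have hsub : ∀ x ∈ ({a, d} : Set A), IsSelfAdjoint x := by
    rintro x (rfl | rfl)
    exacts [ha, hd]
  have hcomm : ∀ x ∈ ({a, d} : Set A), ∀ y ∈ ({a, d} : Set A), x * y = y * x := by
    rintro x (rfl | rfl) y (rfl | rfl)
    exacts [rfl, had.eq, had.eq.symm, rfl]
  have hcomm_star : ∀ x ∈ ({a, d} : Set A), ∀ y ∈ ({a, d} : Set A), x * star y = star y * x := by
    intro x hx y hy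
    rw [(hsub y hy).star_eq]
    exact hcomm x hx y hy
  have hadj := StarAlgebra.isMulCommutative_adjoin ℂ hcomm hcomm_star
  let S : StarSubalgebra ℂ A := (StarAlgebra.adjoin ℂ {a, d}).topologicalClosure
  have hS : IsClosed (S : Set A) := StarSubalgebra.isClosed_topologicalClosure _
  have hle : {a, d} ⊆ (S : Set A) :=
    (StarAlgebra.subset_adjoin ℂ _).trans (StarSubalgebra.le_topologicalClosure _)
  let hring := StarSubalgebra.commRingTopologicalClosure (StarAlgebra.adjoin ℂ {a, d})
    fun x y => hadj.is_comm.comm x y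
  let : CommCStarAlgebra S :=
    { (inferInstance : CStarAlgebra S) with mul_comm := hring.mul_comm }
  let a' : S := ⟨a, hle (by simp)⟩
  let d' : S := ⟨d, hle (by simp)⟩
  have ha' : IsSelfAdjoint a' := Subtype.ext ha
  have hd' : IsSelfAdjoint d' := Subtype.ext hd
  have has' : spectrum ℝ a' ⊆ Ioi 0 := by rwa [spectrum_real_coe]
  have hds' : spectrum ℝ d' ⊆ Ioi 0 := by rwa [spectrum_real_coe]
  have hb' : IsSelfAdjoint (a' * d') := (IsSelfAdjoint.commute_iff ha' hd').mp (mul_comm a' d')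
  have hbs' := spectrum_mul_pos ha' has' hd' hds'
  have hcont : Continuous S.subtype := continuous_subtype_val
  let ι : S →L[ℂ] A := ⟨S.subtype.toLinearMap, hcont⟩
  have hmap : ∀ u ∈ Ioi (0 : ℝ), ι (rearrIntegrand m a' (a' * d') 1 u) =
      rearrIntegrand m a (a * d) 1 u := fun u hu =>
    map_rearrIntegrand S.subtype m ha' has' hb' hbs' 1 hu
  have hint := integrableOn_rearrIntegrand m ha' has' hb' hbs' 1
  refine ⟨IntegrableOn.congr_fun (ι.integrable_comp hint) hmap measurableSet_Ioi, ?_⟩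
  rw [← setIntegral_congr_fun measurableSet_Ioi hmap, ι.integral_comp_comm hint,
    integral_rearrIntegrand_comm m ha' has' hd' hds']
  exact StarAlgHom.map_cfc S.subtype (modLog m) d' ((continuousOn_modLog m).mono hds') hcont hd' hd

end Commuting

/-! ### Faithfulness of the trace and two-sided multiplication on `H_φ` -/

section Faithful

variable {θ : ℝ}

/-- Right multiplication by `Uⁿ Vᵐ`, for `g = (n, m)`, on the basis of `ℓ²(ℤ²)`, up to the constant
phase `e^{2 π i θ n m}`. It commutes with `A_θ`, as right multiplications do. -/
noncomputable def rightShift (θ : ℝ) (g : ℤ × ℤ) : H0 →L[ℂ] H0 :=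
  weightedShift g (fun p => lam θ ^ (p.2 * g.1))

lemma commute_rightShift {a : H0 →L[ℂ] H0} (ha : a ∈ rotationSubalgebra θ) (g : ℤ × ℤ) :
    Commute a (rightShift θ g) := by
  refine commute_right ha ?_ ?_ ?_ ?_ <;>
  · simp only [rightShift, opU, opV, star_weightedShift, Commute, SemiconjBy, weightedShift_mul]
    congr 1
    · abel
    · funext p
      simp [mul_sub, mul_add, zpow_sub, zpow_add, mul_comm, mul_left_comm, mul_assoc]

/-- An operator of the algebra commutes with the right shifts, which carry the vacuum to multiples
of all basis vectors. -/
lemma eq_zero_of_apply_vac {a : H0 →L[ℂ] H0} (ha : a ∈ rotationSubalgebra θ) (h : a vac = 0) :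
    a = 0 := by
  refine lp.ext_continuousLinearMap (by norm_num) fun g => ?_
  refine ContinuousLinearMap.ext_ring ?_
  have h1 : a (rightShift θ g vac) = 0 := by
    have h2 : (a * rightShift θ g) vac = (rightShift θ g * a) vac := by
      rw [(commute_rightShift ha g).eq]
    change a (rightShift θ g vac) = rightShift θ g (a vac) at h2
    rw [h2, h, map_zero]
  rw [rightShift, weightedShift_vac] at h1
  have h3 : lp.single (E := fun _ : ℤ × ℤ => ℂ) 2 g (1 : ℂ) =
      ((lam θ ^ (g.2 * g.1) : Circle) : ℂ)⁻¹ •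
        lp.single 2 g (((lam θ ^ (g.2 * g.1) : Circle) : ℂ)) := by
    rw [← lp.single_smul, smul_eq_mul, inv_mul_cancel₀ (Circle.coe_ne_zero _)]
  change a (lp.single (E := fun _ : ℤ × ℤ => ℂ) 2 g (1 : ℂ)) = 0
  rw [h3, map_smul, h1, smul_zero]

lemma tr_star_mul_self_eq_zero {b : RotationAlgebra θ} (h : tr θ (star b * b) = 0) : b = 0 := by
  rw [tr_apply, map_mul, map_star, mul_apply_eq_comp, ContinuousLinearMap.star_eq_adjoint,
    ContinuousLinearMap.adjoint_inner_right, inner_self_eq_zero] at h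
  exact Subtype.ext (eq_zero_of_apply_vac (toOp_mem b) h)

end Faithful

section Hilbert

variable {θ : ℝ} (h : RotationAlgebra θ) (hh : IsSelfAdjoint h)

lemma exp_neg_half_mul_exp_half :
    exp ((1 / 2 : ℝ) • (-h)) * exp ((1 / 2 : ℝ) • h) = 1 := by
  let : NormedAlgebra ℚ (RotationAlgebra θ) := NormedAlgebra.restrictScalars ℚ ℂ _
  rw [smul_neg, ← exp_add_of_commute (Commute.refl _).neg_left, neg_add_cancel, exp_zero]

/-- If `a` vanishes in `H_φ`, then `τ(b* b) = 0` for `b = a e^{-h/2}`, hence `b = 0`. -/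
lemma toHphi_eq_zero {a : RotationAlgebra θ} (ha : toHphi h hh a = 0) : a = 0 := by
  have h1 : ‖(phi h hh).toPreGNS a‖ = 0 := by
    rw [← UniformSpace.Completion.norm_coe]
    exact norm_eq_zero.mpr ha
  have h2 := (phi h hh).preGNS_norm_sq ((phi h hh).toPreGNS a)
  rw [h1, PositiveLinearMap.ofPreGNS_toPreGNS, phi_star_mul_self] at h2
  have h3 := tr_star_mul_self_eq_zero (h2.symm.trans (by simp))
  rw [← mul_one a, ← exp_neg_half_mul_exp_half h, ← mul_assoc, h3, zero_mul]

/-- The canonical map `A_θ → H_φ`, as a linear map. -/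
noncomputable def toHphiLM : RotationAlgebra θ →ₗ[ℂ] Hphi h hh :=
  (UniformSpace.Completion.toComplₗᵢ (𝕜 := ℂ) (E := (phi h hh).PreGNS)).toLinearMap ∘ₗ
    (phi h hh).toPreGNS.toLinearMap

lemma toHphi_injective : Function.Injective (toHphi h hh) :=
  (injective_iff_map_eq_zero (toHphiLM h hh)).mpr fun _ => toHphi_eq_zero h hh

/-- The canonical map `A_θ → H_φ`, as a continuous linear map. -/
noncomputable def toHphiCLM : RotationAlgebra θ →L[ℂ] Hphi h hh :=
  (toHphiLM h hh).mkContinuous ‖toHphi h hh 1‖ fun a => by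
    have h1 : toHphiLM h hh a = (phi h hh).gnsStarAlgHom a (toHphi h hh 1) := by
      simp [toHphiLM, toHphi]
    rw [h1, mul_comm]
    refine (ContinuousLinearMap.le_opNorm _ _).trans ?_
    gcongr
    exact NonUnitalStarAlgHom.norm_apply_le _ a

lemma toHphiCLM_apply (a : RotationAlgebra θ) : toHphiCLM h hh a = toHphi h hh a := rfl

lemma denseRange_toHphi : DenseRange (toHphi h hh) :=
  UniformSpace.Completion.denseRange_coe.comp (phi h hh).toPreGNS.surjective.denseRange
    (UniformSpace.Completion.continuous_coe _)

lemma phi_star_mul_two_sided_le (p c x : RotationAlgebra θ) :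
    phi h hh (star (p * x * c) * (p * x * c)) ≤
      ((‖p‖ * ‖exp ((1 / 2 : ℝ) • h) * c * exp ((1 / 2 : ℝ) • (-h))‖) ^ 2 : ℝ) •
        phi h hh (star x * x) := by
  rw [phi_star_mul_self, phi_star_mul_self]
  have : p * x * c * exp ((1 / 2 : ℝ) • (-h)) = p * (x * exp ((1 / 2 : ℝ) • (-h))) *
      (exp ((1 / 2 : ℝ) • h) * c * exp ((1 / 2 : ℝ) • (-h))) := by
    calc _ = p * x * 1 * c * exp ((1 / 2 : ℝ) • (-h)) := by rw [mul_one]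
      _ = _ := by
        rw [← exp_neg_half_mul_exp_half h]
        simp only [mul_assoc]
  rw [this]
  exact tr_star_mul_conj_le _ _ _

/-- The bounded operator on `H_φ` that extends `x ↦ p x c`. -/
noncomputable def twoSided (p c : RotationAlgebra θ) : Hphi h hh →L[ℂ] Hphi h hh :=
  (LinearMap.mkContinuous
    { toFun := fun x => (phi h hh).toPreGNS (p * (phi h hh).ofPreGNS x * c)
      map_add' := fun x y => by simp [mul_add, add_mul]
      map_smul' := fun z x => by simp }
    (‖p‖ * ‖exp ((1 / 2 : ℝ) • h) * c * exp ((1 / 2 : ℝ) • (-h))‖) (fun x => by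
    rw [← sq_le_sq₀ (by positivity) (by positivity), mul_pow, ← Complex.real_le_real,
      Complex.ofReal_mul, Complex.ofReal_pow, Complex.ofReal_pow ‖x‖,
      PositiveLinearMap.preGNS_norm_sq, PositiveLinearMap.preGNS_norm_sq]
    simpa using phi_star_mul_two_sided_le h hh p c ((phi h hh).ofPreGNS x)) :
    (phi h hh).PreGNS →L[ℂ] (phi h hh).PreGNS).completion

lemma twoSided_toHphi (p c x : RotationAlgebra θ) :
    twoSided h hh p c (toHphi h hh x) = toHphi h hh (p * x * c) := by
  simp [twoSided, toHphi]

lemma ext_toHphi {S T : Hphi h hh →L[ℂ] Hphi h hh}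
    (hST : ∀ x, S (toHphi h hh x) = T (toHphi h hh x)) : S = T :=
  DFunLike.coe_injective ((denseRange_toHphi h hh).equalizer S.continuous T.continuous
    (funext hST))

lemma twoSided_mul (p c p' c' : RotationAlgebra θ) :
    twoSided h hh p c * twoSided h hh p' c' = twoSided h hh (p * p') (c' * c) := by
  refine ext_toHphi h hh fun x => ?_
  rw [mul_apply_eq_comp]
  simp only [twoSided_toHphi, mul_assoc]

lemma twoSided_one : twoSided h hh 1 1 = 1 := by
  refine ext_toHphi h hh fun x => ?_
  rw [twoSided_toHphi, one_mul, mul_one]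
  rfl

lemma modularOp_eq_twoSided : modularOp h hh = twoSided h hh (exp (-h)) (exp h) :=
  ext_toHphi h hh fun x => by rw [modularOp_toHphi, twoSided_toHphi]

lemma inner_toHphi (x y : RotationAlgebra θ) :
    ⟪toHphi h hh x, toHphi h hh y⟫_ℂ = tr θ (star x * y * exp (-h)) := by
  rw [toHphi, toHphi, UniformSpace.Completion.inner_coe, PositiveLinearMap.preGNS_inner_def]
  rfl

/-- Right multiplication by `c` is symmetric for `φ` because `c` commutes with the density
`e^{-h}` of `φ`. -/
lemma isSelfAdjoint_twoSided {p c : RotationAlgebra θ} (hp : IsSelfAdjoint p)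
    (hc : IsSelfAdjoint c) (hch : Commute c h) : IsSelfAdjoint (twoSided h hh p c) := by
  let : NormedAlgebra ℚ (RotationAlgebra θ) := NormedAlgebra.restrictScalars ℚ ℂ _
  rw [ContinuousLinearMap.isSelfAdjoint_iff_isSymmetric]
  have hce : Commute c (exp (-h)) := hch.neg_right.exp_right
  have key : ∀ x y, ⟪twoSided h hh p c (toHphi h hh x), toHphi h hh y⟫_ℂ =
      ⟪toHphi h hh x, twoSided h hh p c (toHphi h hh y)⟫_ℂ := fun x y => by
    rw [twoSided_toHphi, twoSided_toHphi, inner_toHphi, inner_toHphi, star_mul, star_mul,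
      hp.star_eq, hc.star_eq]
    calc _ = tr θ (c * (star x * p * y * exp (-h))) := by simp only [mul_assoc]
      _ = tr θ (star x * p * y * (exp (-h) * c)) := by rw [tr_mul_comm]; simp only [mul_assoc]
      _ = _ := by rw [← hce.eq]; simp only [mul_assoc]
  intro ξ η
  refine (denseRange_toHphi h hh).induction_on₂ (p := fun ξ η =>
    ⟪twoSided h hh p c ξ, η⟫_ℂ = ⟪ξ, twoSided h hh p c η⟫_ℂ) ?_ key ξ η
  exact isClosed_eq (by fun_prop) (by fun_prop)

/-- The operator is the square of the invertible self-adjoint operator `x ↦ s x t`, whose inverse is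
`x ↦ s' x t'`. -/
lemma spectrum_twoSided_pos {s t s' t' : RotationAlgebra θ} (hs : IsSelfAdjoint s)
    (ht : IsSelfAdjoint t) (hth : Commute t h) (hs1 : s * s' = 1) (hs2 : s' * s = 1)
    (ht1 : t * t' = 1) (ht2 : t' * t = 1) :
    spectrum ℝ (twoSided h hh (s * s) (t * t)) ⊆ Ioi 0 := by
  rw [← twoSided_mul]
  refine spectrum_mul_self_pos (isSelfAdjoint_twoSided h hh hs ht hth) ?_
  exact ⟨⟨twoSided h hh s t, twoSided h hh s' t', by rw [twoSided_mul, hs1, ht2, twoSided_one],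
    by rw [twoSided_mul, hs2, ht1, twoSided_one]⟩, rfl⟩

end Hilbert

/-! ### The modular operator -/

section ModularOp

variable {θ : ℝ} (h : RotationAlgebra θ)

lemma exp_half_mul_exp_neg_half : exp ((1 / 2 : ℝ) • h) * exp ((1 / 2 : ℝ) • (-h)) = 1 := by
  simpa using exp_neg_half_mul_exp_half (-h)

lemma isSelfAdjoint_exp_half {h : RotationAlgebra θ} (hh : IsSelfAdjoint h) :
    IsSelfAdjoint (exp ((1 / 2 : ℝ) • h)) :=
  ((IsSelfAdjoint.all (1 / 2 : ℝ)).smul hh).exp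

lemma weyl_sq : weyl h ^ 2 = exp h := by
  rw [sq, weyl, exp_half_mul]

lemma spectrum_exp_pos {h : RotationAlgebra θ} (hh : IsSelfAdjoint h) :
    spectrum ℝ (exp h) ⊆ Ioi 0 := by
  rw [← exp_half_mul]
  exact spectrum_mul_self_pos (isSelfAdjoint_exp_half hh)
    ⟨⟨_, _, exp_half_mul_exp_neg_half h, exp_neg_half_mul_exp_half h⟩, rfl⟩

lemma moveIntegrand_eq (m : ℕ) (ρ : RotationAlgebra θ) (u : ℝ) :
    moveIntegrand h m ρ u = rearrIntegrand m (exp h) (exp h) ρ u := by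
  have h1 : weyl h ^ (2 * m + 2) = exp h ^ (m + 1) := by
    rw [← weyl_sq, ← pow_mul, mul_add, mul_one]
  rw [moveIntegrand, rearrIntegrand, weyl_sq, h1]

variable (hh : IsSelfAdjoint h)

lemma commute_exp_half : Commute (exp ((1 / 2 : ℝ) • h)) h := by
  let : NormedAlgebra ℚ (RotationAlgebra θ) := NormedAlgebra.restrictScalars ℚ ℂ _
  exact ((Commute.refl h).smul_left _).exp_left

lemma spectrum_leftExp_pos : spectrum ℝ (twoSided h hh (exp h) 1) ⊆ Ioi 0 := by
  have := spectrum_twoSided_pos h hh (isSelfAdjoint_exp_half hh) (.one _) (Commute.one_left h)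
    (exp_half_mul_exp_neg_half h) (exp_neg_half_mul_exp_half h) (mul_one 1) (mul_one 1)
  rwa [exp_half_mul, mul_one] at this

lemma spectrum_rightExp_pos : spectrum ℝ (twoSided h hh 1 (exp h)) ⊆ Ioi 0 := by
  have := spectrum_twoSided_pos h hh (.one _) (isSelfAdjoint_exp_half hh) (commute_exp_half h)
    (mul_one 1) (mul_one 1) (exp_half_mul_exp_neg_half h) (exp_neg_half_mul_exp_half h)
  rwa [exp_half_mul, mul_one] at this

lemma isSelfAdjoint_modularOp : IsSelfAdjoint (modularOp h hh) := by
  let : NormedAlgebra ℚ (RotationAlgebra θ) := NormedAlgebra.restrictScalars ℚ ℂ _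
  rw [modularOp_eq_twoSided]
  exact isSelfAdjoint_twoSided h hh hh.neg.exp hh.exp (Commute.refl h).exp_left

lemma spectrum_modularOp_pos : spectrum ℝ (modularOp h hh) ⊆ Ioi 0 := by
  have := spectrum_twoSided_pos h hh (isSelfAdjoint_exp_half hh.neg) (isSelfAdjoint_exp_half hh)
    (commute_exp_half h) (exp_neg_half_mul_exp_half h) (exp_half_mul_exp_neg_half h)
    (exp_half_mul_exp_neg_half h) (exp_neg_half_mul_exp_half h)
  rwa [exp_half_mul, exp_half_mul, ← modularOp_eq_twoSided] at this

lemma exp_mul_exp_neg : exp h * exp (-h) = 1 := by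
  let : NormedAlgebra ℚ (RotationAlgebra θ) := NormedAlgebra.restrictScalars ℚ ℂ _
  rw [← exp_add_of_commute (Commute.refl h).neg_right, add_neg_cancel, exp_zero]

lemma exp_neg_mul_exp : exp (-h) * exp h = 1 := by
  simpa using exp_mul_exp_neg (-h)

lemma leftExp_mul_modularOp :
    twoSided h hh (exp h) 1 * modularOp h hh = twoSided h hh 1 (exp h) := by
  rw [modularOp_eq_twoSided, twoSided_mul, exp_mul_exp_neg, mul_one]

lemma commute_leftExp_modularOp : Commute (twoSided h hh (exp h) 1) (modularOp h hh) := by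
  rw [Commute, SemiconjBy, leftExp_mul_modularOp, modularOp_eq_twoSided, twoSided_mul,
    exp_neg_mul_exp, one_mul]

lemma toHphi_add (x y : RotationAlgebra θ) :
    toHphi h hh (x + y) = toHphi h hh x + toHphi h hh y := map_add (toHphiCLM h hh) x y

lemma toHphi_real_smul (u : ℝ) (x : RotationAlgebra θ) :
    toHphi h hh (u • x) = u • toHphi h hh x := by
  rw [← Complex.coe_smul, ← Complex.coe_smul]
  exact map_smul (toHphiCLM h hh) (u : ℂ) x

lemma leftExp_pow_toHphi (n : ℕ) (x : RotationAlgebra θ) :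
    (twoSided h hh (exp h) 1 ^ n) (toHphi h hh x) = toHphi h hh (exp h ^ n * x) := by
  induction n with
  | zero => simp
  | succ n ih => rw [pow_succ', mul_apply_eq_comp, ih, twoSided_toHphi, mul_one, ← mul_assoc,
      ← pow_succ']

lemma smul_leftExp_add_one_pow_toHphi (u : ℝ) (n : ℕ) (x : RotationAlgebra θ) :
    ((u • twoSided h hh (exp h) 1 + 1) ^ n) (toHphi h hh x) =
      toHphi h hh ((u • exp h + 1) ^ n * x) := by
  have h1 : ∀ y, (u • twoSided h hh (exp h) 1 + 1) (toHphi h hh y) =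
      toHphi h hh ((u • exp h + 1) * y) := fun y => by
    rw [add_mul, smul_mul_assoc, one_mul, toHphi_add, toHphi_real_smul]
    simp [twoSided_toHphi]
  induction n with
  | zero => simp
  | succ n ih => rw [pow_succ', mul_apply_eq_comp, ih, h1, ← mul_assoc, ← pow_succ']

lemma smul_rightExp_add_one_toHphi (u : ℝ) (x : RotationAlgebra θ) :
    (u • twoSided h hh 1 (exp h) + 1) (toHphi h hh x) =
      toHphi h hh (x * (u • exp h + 1)) := by
  rw [mul_add, mul_smul_comm, mul_one, toHphi_add, toHphi_real_smul]
  simp [twoSided_toHphi]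

/-- On `H_φ` the integrand with coefficients on both sides of `ρ` is a product of commuting
operators applied to `ρ`. -/
lemma toHphi_rearrIntegrand (m : ℕ) (ρ : RotationAlgebra θ) {u : ℝ} (hu : 0 < u) :
    toHphi h hh (rearrIntegrand m (exp h) (exp h) ρ u) =
      rearrIntegrand m (twoSided h hh (exp h) 1) (twoSided h hh 1 (exp h)) 1 u
        (toHphi h hh ρ) := by
  have hL : IsSelfAdjoint (twoSided h hh (exp h) 1) :=
    isSelfAdjoint_twoSided h hh hh.exp (.one _) (Commute.one_left h)
  have hR : IsSelfAdjoint (twoSided h hh 1 (exp h)) := by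
    let : NormedAlgebra ℚ (RotationAlgebra θ) := NormedAlgebra.restrictScalars ℚ ℂ _
    exact isSelfAdjoint_twoSided h hh (.one _) hh.exp (Commute.refl h).exp_left
  have hLu := (isUnit_smul_add_one hL (spectrum_leftExp_pos h hh) hu.le).pow (m + 1)
  have hRu := isUnit_smul_add_one hR (spectrum_rightExp_pos h hh) hu.le
  have hKu := isUnit_smul_add_one hh.exp (spectrum_exp_pos hh) hu.le
  have hinvR : ∀ x, Ring.inverse (u • twoSided h hh 1 (exp h) + 1) (toHphi h hh x) =
      toHphi h hh (x * Ring.inverse (u • exp h + 1)) := fun x => by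
    have h1 := smul_rightExp_add_one_toHphi h hh u (x * Ring.inverse (u • exp h + 1))
    rw [mul_assoc, Ring.inverse_mul_cancel _ hKu, mul_one] at h1
    rw [← h1, ← mul_apply_eq_comp, Ring.inverse_mul_cancel _ hRu, one_apply_eq_self]
  have hinvL : ∀ x, Ring.inverse ((u • twoSided h hh (exp h) 1 + 1) ^ (m + 1)) (toHphi h hh x) =
      toHphi h hh (Ring.inverse ((u • exp h + 1) ^ (m + 1)) * x) := fun x => by
    have h1 := smul_leftExp_add_one_pow_toHphi h hh u (m + 1)
      (Ring.inverse ((u • exp h + 1) ^ (m + 1)) * x)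
    rw [← mul_assoc, Ring.mul_inverse_cancel _ (hKu.pow _), one_mul] at h1
    rw [← h1, ← mul_apply_eq_comp, Ring.inverse_mul_cancel _ hLu, one_apply_eq_self]
  rw [rearrIntegrand, rearrIntegrand, mul_one, toHphi_real_smul]
  change _ = u ^ m • (twoSided h hh (exp h) 1 ^ (m + 1))
    (Ring.inverse ((u • twoSided h hh (exp h) 1 + 1) ^ (m + 1))
      (Ring.inverse (u • twoSided h hh 1 (exp h) + 1) (toHphi h hh ρ)))
  rw [hinvR, hinvL, leftExp_pow_toHphi]
  simp only [mul_assoc]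

theorem toHphi_integral_rearrIntegrand (m : ℕ) (ρ : RotationAlgebra θ) :
    toHphi h hh (∫ u in Ioi (0 : ℝ), rearrIntegrand m (exp h) (exp h) ρ u) =
      cfc (modLog m) (modularOp h hh) (toHphi h hh ρ) := by
  have hs := spectrum_exp_pos hh
  have hL : IsSelfAdjoint (twoSided h hh (exp h) 1) :=
    isSelfAdjoint_twoSided h hh hh.exp (.one _) (Commute.one_left h)
  obtain ⟨hint, hval⟩ := integral_rearrIntegrand_of_commute m hL (spectrum_leftExp_pos h hh)
    (isSelfAdjoint_modularOp h hh) (spectrum_modularOp_pos h hh) (commute_leftExp_modularOp h hh)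
  rw [leftExp_mul_modularOp] at hint hval
  rw [← hval, ContinuousLinearMap.integral_apply hint, ← toHphiCLM_apply,
    ← ContinuousLinearMap.integral_comp_comm _
      (integrableOn_rearrIntegrand m hh.exp hs hh.exp hs ρ)]
  exact setIntegral_congr_fun measurableSet_Ioi fun u hu => toHphi_rearrIntegrand h hh m ρ hu

end ModularOp

end NCTorus

theorem lemma5 (θ : ℝ) (hθ : Irrational θ) (h : RotationAlgebra θ) (hh : IsSelfAdjoint h)
    (hsm : IsSmooth h) (m : ℕ) :
    -- the function `𝓛_m` is well defined, and is the modified logarithm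
    (∀ u : ℝ, 0 < u → MeasureTheory.IntegrableOn (modLogIntegrand m u) (Set.Ioi 0)) ∧
    ContinuousOn (modLog m) (Set.Ioi 0) ∧
    (∀ u : ℝ, 0 < u → u ≠ 1 →
      modLog m u = (-1) ^ m * ((u - 1) ^ (m + 1))⁻¹ *
        (Real.log u - ∑ j ∈ Finset.Icc 1 m, (-1) ^ (j + 1) * (u - 1) ^ j / (j : ℝ))) ∧
    -- `𝓛_m(Δ)` is well defined on `H_φ`, in which `A_θ` embeds
    IsSelfAdjoint (modularOp h hh) ∧
    spectrum ℝ (modularOp h hh) ⊆ Set.Ioi 0 ∧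
    Function.Injective (toHphi h hh) ∧
    -- the inverses in the integrand exist
    (∀ u : ℝ, 0 < u → IsUnit (u • weyl h ^ 2 + 1)) ∧
    -- the rearrangement formula
    (∀ ρ : RotationAlgebra θ, IsSmooth ρ →
      MeasureTheory.IntegrableOn (moveIntegrand h m ρ) (Set.Ioi 0) ∧
      toHphi h hh (∫ u in Set.Ioi (0 : ℝ), moveIntegrand h m ρ u) =
        cfc (modLog m) (modularOp h hh) (toHphi h hh ρ)) := by
  have hs := spectrum_exp_pos hh
  refine ⟨fun u hu => integrableOn_modLogIntegrand m hu, continuousOn_modLog m,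
    fun u hu hu1 => modLog_eq m hu hu1, isSelfAdjoint_modularOp h hh, spectrum_modularOp_pos h hh,
    toHphi_injective h hh, fun u hu => ?_, fun ρ _ => ?_⟩
  · rw [weyl_sq]
    exact isUnit_smul_add_one hh.exp hs hu.le
  · rw [funext (moveIntegrand_eq h m ρ)]
    exact ⟨integrableOn_rearrIntegrand m hh.exp hs hh.exp hs ρ,
      toHphi_integral_rearrIntegrand h hh m ρ⟩
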